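/- **Setting.** Fix $\alpha\in(0,\pi/2)$. A drone at $P=(p_1,p_2)$, $p_2\ge 0$, covers the points $(a,0)$ with $|a-p_1|\le p_2\tan\alpha$. Requests $x_0=0,x_1,\dots,x_n$ on the $x$-axis arrive one at a time. A solution is a sequence of positions $P_0=(0,0),P_1,\dots,P_n$ such that $P_i$ covers $x_0,\dots,x_i$ for every $i$; its cost is $\sum_{i<n}|P_iP_{i+1}|$, and $\mathrm{OPT}(x;\alpha)$ is the least cost of a solution. An input is *good* if $x_0=0$, no $x_{i+1}$ lies in $[\min_{j\le i}x_j,\max_{j\le i}x_j]$, and it is scaled and flipped so that $\min_j x_j=-1$ and $r:=\max_j x_j\le 1$. The competitive ratio of an algorithm is the supremum, over all good inputs, of its cost divided by $\mathrm{OPT}$. For $\beta\in[0,\alpha]$, the $\beta$-Hedge algorithm starts at $P_0=(0,0)$ and in round $i$ moves from $P_{i-1}$ in a straight line at angle $\beta$ to the vertical, upwards and towards the side of $x_i$, until it reaches the first point $P_i$ that covers $x_0,\dots,x_i$ (so it does not move if $P_{i-1}$ already covers them). Let $\rho(\alpha,\beta)$ be its competitive ratio. Put $$f_1(\alpha,\beta,r)=\frac{2\sin\alpha}{\cos\beta\,(\tan\alpha+\tan\beta)}\cdot\frac{1+\frac{2\tan\beta}{\tan\alpha+\tan\beta}\,r}{\sqrt{1+r^2+2r\cos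 2\alpha}},\qquad r_0(\alpha,\beta)=\frac{2A-B}{2-AB},$$ where $A=\frac{2\tan\beta}{\tan\alpha+\tan\beta}$ and $B=2\cos2\alpha$. **Theorem.** For every $\alpha\in(0,\pi/2)$, the unique minimizer of $\rho(\alpha,\beta)$ over $\beta\in[0,\alpha]$ is $$\beta_0(\alpha)=\begin{cases}\alpha,&\alpha\in(0,\pi/6],\\ \tfrac12\arccos\dfrac{2-2\cos4\alpha+\cos6\alpha}{3-2\cos4\alpha},&\alpha\in(\pi/6,\pi/3),\\ 0,&\alpha\in[\pi/3,\pi/2),\end{cases}$$ and the resulting competitive ratio is $$\rho(\alpha,\beta_0)=\begin{cases}1/\cos\alpha,&\alpha\in(0,\pi/6),\\ f_1(\alpha,\beta_0,r_0(\alpha,\beta_0)),&\alpha\in[\pi/6,\pi/3],\\ 1/\sin\alpha,&\alpha\in[\pi/3,\pi/2);\end{cases}$$ in particular it equals $5/4$ at $\alpha=\pi/4$. The analysis is tight: the supremum defining $\rho(\alpha,\beta_0)$ is attained by a good input whose rightmost request is $r_0(\alpha,\beta_0)$. Moreover $r_0(\alpha,\beta_0)=1$ if $\alpha\le\pi/6$,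 and $r_0(\alpha,\beta_0)=-\cos2\alpha$ if $\alpha\ge\pi/3$. -/

import Mathlib

open Real Set

noncomputable section

namespace Drone

/-- The plane, with the Euclidean distance; `P 0` is the horizontal coordinate and `P 1` the height. -/
abbrev Plane : Type := EuclideanSpace ℝ (Fin 2)

/-- Drone locations, on or above the ground, whose coverage interval
`[P 0 - P 1 * tan α, P 0 + P 1 * tan α]` contains the ground point `(a, 0)`. -/
def feasibilityConePoint (α a : ℝ) : Set Plane :=
  {P | 0 ≤ P 1 ∧ P 0 - P 1 * tan α ≤ a ∧ a ≤ P 0 + P 1 * tan α}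

/-- Feasibility cone of the requests `x 0, …, x i`. -/
def feasibilityCone (α : ℝ) (x : ℕ → ℝ) (i : ℕ) : Set Plane :=
  {P | ∀ j ≤ i, P ∈ feasibilityConePoint α (x j)}

/-- The smallest coordinate among the requests `x 0, …, x i`. -/
def leftmost (x : ℕ → ℝ) (i : ℕ) : ℝ :=
  (Finset.range (i + 1)).inf' Finset.nonempty_range_add_one x

/-- The largest coordinate among the requests `x 0, …, x i`. -/
def rightmost (x : ℕ → ℝ) (i : ℕ) : ℝ :=
  (Finset.range (i + 1)).sup' Finset.nonempty_range_add_one x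

/-- Good request sequences `x 0, …, x n` (later values of `x` are irrelevant): the first request is
the origin, no request is redundant, and the sequence is scaled and flipped so that the leftmost
request is `-1` and the rightmost one is at most `1`. -/
structure GoodInput (n : ℕ) (x : ℕ → ℝ) : Prop where
  zero : x 0 = 0
  nonredundant : ∀ i < n, x (i + 1) ∉ Icc (leftmost x i) (rightmost x i)
  left : leftmost x n = -1
  right : rightmost x n ≤ 1

/-- Total length of the polygonal path `P 0, …, P n`. -/
def netCost (P : ℕ → Plane) (n : ℕ) : ℝ :=
  ∑ i ∈ Finset.range n, dist (P i) (P (i + 1))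

/-- Solutions: the drone starts at the origin and `P i` covers `x 0, …, x i`. -/
def IsSolution (α : ℝ) (x : ℕ → ℝ) (n : ℕ) (P : ℕ → Plane) : Prop :=
  P 0 = 0 ∧ ∀ i ≤ n, P i ∈ feasibilityCone α x i

/-- Optimal offline cost. -/
def opt (α : ℝ) (x : ℕ → ℝ) (n : ℕ) : ℝ :=
  sInf {c | ∃ P : ℕ → Plane, IsSolution α x n P ∧ netCost P n = c}

/-- Competitive ratio, as a supremum over all good inputs, of an algorithm given by its sequence of
drone positions on each request sequence. -/
def competitiveRatio (α : ℝ) (alg : (ℕ → ℝ) → ℕ → Plane) : EReal :=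
  ⨆ (n : ℕ) (x : ℕ → ℝ) (_ : GoodInput n x), ((netCost (alg x) n / opt α x n : ℝ) : EReal)

/-- Distance from `P` to the first point of `S` on the ray from `P` in the direction `u`. -/
def hitDistance (P u : Plane) (S : Set Plane) : ℝ :=
  sInf {t | 0 ≤ t ∧ P + t • u ∈ S}

/-- Unit vector at angle `β` with the vertical, pointing to the side of `P` on which the ground
point `(a, 0)` lies. -/
def hedgeDirection (β : ℝ) (P : Plane) (a : ℝ) : Plane :=
  if P 0 ≤ a then !₂[sin β, cos β] else !₂[-sin β, cos β]

/-- Drone positions of the `β`-Hedge algorithm: in each round the drone moves at angle `β` to the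
vertical, towards the side of the new request, until it reaches the feasibility cone of all requests
seen so far (so it stays put if it is already there). -/
def betaHedge (α β : ℝ) (x : ℕ → ℝ) : ℕ → Plane
  | 0 => 0
  | i + 1 =>
    betaHedge α β x i +
      hitDistance (betaHedge α β x i) (hedgeDirection β (betaHedge α β x i) (x (i + 1)))
          (feasibilityCone α x (i + 1)) •
        hedgeDirection β (betaHedge α β x i) (x (i + 1))

def f₁ (α β r : ℝ) : ℝ :=
  2 * sin α / (cos β * (tan α + tan β)) *
    ((1 + 2 * tan β / (tan α + tan β) * r) / √(1 + r ^ 2 + 2 * cos (2 * α) * r))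

def coeffA (α β : ℝ) : ℝ := 2 * tan β / (tan α + tan β)

def coeffB (α : ℝ) : ℝ := 2 * cos (2 * α)

def r₀ (α β : ℝ) : ℝ :=
  (2 * coeffA α β - coeffB α) / (2 - coeffA α β * coeffB α)

def β₀ (α : ℝ) : ℝ :=
  if α ≤ π / 6 then α
  else if α < π / 3 then
    1 / 2 * arccos ((2 - 2 * cos (4 * α) + cos (6 * α)) / (3 - 2 * cos (4 * α)))
  else 0

end Drone

end

/-! Describe a drone by its coverage to the right, `u`, and to the left, `v`. A hedge move that
raises one of them by `δ` raises the other by `(1 - A) * δ`, where `A = coeffA α β`, and costs `δ /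
hedgeSpeed α β`. If `p` and `q` are the total gains from right and left moves, the cost is `(p + q)
/ hedgeSpeed`; a final left move ends with `q + (1 - A) * p = 1`, so `p + q = 1 + A * p ≤ 1 + A * r`
(`betaHedge_invariant`, `netCost_betaHedge_le`).

The norm is a quadratic form in `(u, v)` (`norm_sq_eq`). Cauchy–Schwarz for this form bounds `v + A
* u` by a multiple of the norm, which gives the upper bound `hedgeRatio`. The inputs `0, r, -1` give
the lower bound `f₁ α β r`, and `r₀` is the equality case (`f₁_r₀`), available when `cos (2 * α) ≤
A`.

Finally `β` is traded for `A ∈ [0, 1]`. The squared `hedgeRatio` is a quartic in `A` over a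
constant, minimized at `1/2 + cos (2 * α)` clamped to `[0, 1]` (`ratioPoly_bestCoeff_lt`). Where
`r₀` is negative, the input `0, -1` already rules `β` out. -/

namespace Drone

/-! ### Coverage coordinates and hedge speeds -/

/-- The right end of the coverage interval of `P`. -/
noncomputable def coverRight (α : ℝ) (P : Plane) : ℝ := P 0 + P 1 * tan α

/-- The negative of the left end of the coverage interval of `P`. -/
noncomputable def coverLeft (α : ℝ) (P : Plane) : ℝ := P 1 * tan α - P 0

/-- Growth rate of the coverage on the side towards which the `β`-Hedge algorithm moves. -/
noncomputable def hedgeSpeed (α β : ℝ) : ℝ := sin β + cos β * tan α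

lemma hedgeSpeed_pos {α β : ℝ} (hα : α ∈ Ioo 0 (π / 2)) (hβ : β ∈ Icc 0 α) :
    0 < hedgeSpeed α β := by
  have h1 : 0 ≤ sin β := sin_nonneg_of_nonneg_of_le_pi hβ.1 (by linarith [hβ.2, hα.2, pi_pos])
  have h2 : 0 < cos β := cos_pos_of_mem_Ioo ⟨by linarith [hβ.1, pi_pos], by linarith [hβ.2, hα.2]⟩
  have h3 := tan_pos_of_pos_of_lt_pi_div_two hα.1 hα.2
  unfold hedgeSpeed
  positivity

lemma tan_mem_Icc {α β : ℝ} (hα : α ∈ Ioo 0 (π / 2)) (hβ : β ∈ Icc 0 α) :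
    tan β ∈ Icc 0 (tan α) := by
  refine ⟨tan_nonneg_of_nonneg_of_le_pi_div_two hβ.1 (by linarith [hβ.2, hα.2]), ?_⟩
  exact strictMonoOn_tan.monotoneOn ⟨by linarith [hβ.1, pi_pos], by linarith [hβ.2, hα.2]⟩
    ⟨by linarith [hα.1, pi_pos], hα.2⟩ hβ.2

lemma coeffA_mem_Icc {α β : ℝ} (hα : α ∈ Ioo 0 (π / 2)) (hβ : β ∈ Icc 0 α) :
    coeffA α β ∈ Icc 0 1 := by
  obtain ⟨h1, h2⟩ := tan_mem_Icc hα hβ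
  have h3 := tan_pos_of_pos_of_lt_pi_div_two hα.1 hα.2
  unfold coeffA
  constructor
  · positivity
  · rw [div_le_one (by positivity)]; linarith

lemma cos_pos_of_mem {α β : ℝ} (hα : α ∈ Ioo 0 (π / 2)) (hβ : β ∈ Icc 0 α) : 0 < cos β :=
  cos_pos_of_mem_Ioo ⟨by linarith [hβ.1, pi_pos], by linarith [hβ.2, hα.2]⟩

lemma hedgeSpeed_eq {α β : ℝ} (hα : α ∈ Ioo 0 (π / 2)) (hβ : β ∈ Icc 0 α) :
    hedgeSpeed α β = cos β * (tan α + tan β) := by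
  have h2 := cos_pos_of_mem hα hβ
  rw [hedgeSpeed, mul_add, mul_comm (cos β) (tan β), tan_mul_cos h2.ne', add_comm]

/-- Growth rate of the coverage on the opposite side. -/
lemma cos_mul_tan_sub_sin {α β : ℝ} (hα : α ∈ Ioo 0 (π / 2)) (hβ : β ∈ Icc 0 α) :
    cos β * tan α - sin β = (1 - coeffA α β) * hedgeSpeed α β := by
  have h2 := cos_pos_of_mem hα hβ
  have h3 := tan_pos_of_pos_of_lt_pi_div_two hα.1 hα.2
  have h4 := (tan_mem_Icc hα hβ).1
  have h5 : tan α + tan β ≠ 0 := by positivity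
  rw [hedgeSpeed_eq hα hβ, coeffA, ← tan_mul_cos h2.ne']
  field_simp
  ring

lemma mem_feasibilityCone {α : ℝ} {x : ℕ → ℝ} {i : ℕ} {P : Plane} :
    P ∈ feasibilityCone α x i ↔
      ∀ j ≤ i, 0 ≤ P 1 ∧ -coverLeft α P ≤ x j ∧ x j ≤ coverRight α P := by
  simp only [feasibilityCone, feasibilityConePoint, coverLeft, coverRight, mem_ofPred_eq, neg_sub]

lemma coverRight_add_smul (α s a b : ℝ) (P : Plane) :
    coverRight α (P + s • !₂[a, b]) = coverRight α P + s * (a + b * tan α) := by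
  simp [coverRight]; ring

lemma coverLeft_add_smul (α s a b : ℝ) (P : Plane) :
    coverLeft α (P + s • !₂[a, b]) = coverLeft α P + s * (b * tan α - a) := by
  simp [coverLeft]; ring

lemma dist_add_smul_unit (P : Plane) {s a b : ℝ} (hs : 0 ≤ s) (h : a ^ 2 + b ^ 2 = 1) :
    dist P (P + s • !₂[a, b]) = s := by
  rw [dist_self_add_right, norm_smul, EuclideanSpace.norm_eq]
  simp [h, abs_of_nonneg hs]

/-! ### One round of the algorithm -/

section Step

variable {α β : ℝ} {x : ℕ → ℝ} {i : ℕ}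

lemma betaHedge_succ_of_covered
    (hP : betaHedge α β x i ∈ feasibilityCone α x i)
    (hl : -coverLeft α (betaHedge α β x i) ≤ x (i + 1))
    (hr : x (i + 1) ≤ coverRight α (betaHedge α β x i)) :
    betaHedge α β x (i + 1) = betaHedge α β x i := by
  have h0 : hitDistance (betaHedge α β x i)
      (hedgeDirection β (betaHedge α β x i) (x (i + 1))) (feasibilityCone α x (i + 1)) = 0 := by
    refine IsLeast.csInf_eq ⟨⟨le_rfl, ?_⟩, fun t ht => ht.1⟩
    rw [zero_smul, add_zero, mem_feasibilityCone]
    rw [mem_feasibilityCone] at hP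
    intro j hj
    rcases Nat.le_succ_iff.1 hj with h | rfl
    · exact hP j h
    · exact ⟨(hP 0 (Nat.zero_le _)).1, hl, hr⟩
  simp [betaHedge, h0]

/-- Since `β ≤ α`, the left end of the coverage never retreats during a right move, so the only
active constraint is the new request. -/
lemma betaHedge_succ_of_right (hα : α ∈ Ioo 0 (π / 2)) (hβ : β ∈ Icc 0 α)
    (hP : betaHedge α β x i ∈ feasibilityCone α x i)
    (hr : coverRight α (betaHedge α β x i) ≤ x (i + 1)) :
    betaHedge α β x (i + 1) = betaHedge α β x i +
      ((x (i + 1) - coverRight α (betaHedge α β x i)) / hedgeSpeed α β) • !₂[sin β, cos β] := by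
  have hW := hedgeSpeed_pos hα hβ
  have ht := tan_pos_of_pos_of_lt_pi_div_two hα.1 hα.2
  have hP' := mem_feasibilityCone.1 hP
  have hp1 := (hP' 0 (Nat.zero_le _)).1
  have hlr : -coverLeft α (betaHedge α β x i) ≤ coverRight α (betaHedge α β x i) :=
    (hP' 0 (Nat.zero_le _)).2.1.trans (hP' 0 (Nat.zero_le _)).2.2
  have hdir : hedgeDirection β (betaHedge α β x i) (x (i + 1)) = !₂[sin β, cos β] := by
    rw [hedgeDirection, if_pos]
    have := mul_nonneg hp1 ht.le
    unfold coverRight at hr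
    linarith
  have hit : hitDistance (betaHedge α β x i) !₂[sin β, cos β] (feasibilityCone α x (i + 1)) =
      (x (i + 1) - coverRight α (betaHedge α β x i)) / hedgeSpeed α β := by
    have hs : 0 ≤ (x (i + 1) - coverRight α (betaHedge α β x i)) / hedgeSpeed α β :=
      div_nonneg (by linarith) hW.le
    have hA : 0 ≤ cos β * tan α - sin β := by
      rw [cos_mul_tan_sub_sin hα hβ]
      exact mul_nonneg (by linarith [(coeffA_mem_Icc hα hβ).2]) hW.le
    refine IsLeast.csInf_eq ⟨⟨hs, ?_⟩, ?_⟩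
    · rw [mem_feasibilityCone, coverRight_add_smul, coverLeft_add_smul]
      have e1 : coverRight α (betaHedge α β x i) + (x (i + 1) -
          coverRight α (betaHedge α β x i)) / hedgeSpeed α β * (sin β + cos β * tan α) =
          x (i + 1) := by
        change _ + _ / _ * hedgeSpeed α β = _
        rw [div_mul_cancel₀ _ hW.ne']; ring
      have e2 := mul_nonneg hs hA
      rw [e1]
      intro j hj
      refine ⟨?_, ?_, ?_⟩
      · have := mul_nonneg hs (cos_pos_of_mem hα hβ).le
        simp only [PiLp.add_apply, PiLp.smul_apply, smul_eq_mul]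
        simpa using add_nonneg hp1 this
      · rcases Nat.le_succ_iff.1 hj with h | rfl
        · linarith [(hP' j h).2.1]
        · linarith
      · rcases Nat.le_succ_iff.1 hj with h | rfl
        · linarith [(hP' j h).2.2]
        · exact le_rfl
    · rintro τ ⟨-, hτ⟩
      rw [mem_feasibilityCone, coverRight_add_smul] at hτ
      rw [div_le_iff₀ hW]
      have := (hτ (i + 1) le_rfl).2.2
      unfold hedgeSpeed
      linarith
  rw [betaHedge, hdir, hit]

lemma betaHedge_succ_of_left (hα : α ∈ Ioo 0 (π / 2)) (hβ : β ∈ Icc 0 α)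
    (hP : betaHedge α β x i ∈ feasibilityCone α x i)
    (hl : x (i + 1) ≤ -coverLeft α (betaHedge α β x i)) :
    betaHedge α β x (i + 1) = betaHedge α β x i +
      ((-x (i + 1) - coverLeft α (betaHedge α β x i)) / hedgeSpeed α β) • !₂[-sin β, cos β] := by
  have hW := hedgeSpeed_pos hα hβ
  have ht := tan_pos_of_pos_of_lt_pi_div_two hα.1 hα.2
  have hP' := mem_feasibilityCone.1 hP
  have hp1 := (hP' 0 (Nat.zero_le _)).1
  have hlr : -coverLeft α (betaHedge α β x i) ≤ coverRight α (betaHedge α β x i) :=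
    (hP' 0 (Nat.zero_le _)).2.1.trans (hP' 0 (Nat.zero_le _)).2.2
  -- At height `0` a request at the left end lies exactly below the drone, and the tie in
  -- `hedgeDirection` points right; the move then has length `0`, so the direction is irrelevant.
  rcases hl.eq_or_lt with heq | hl
  · rw [betaHedge_succ_of_covered hP heq.ge (heq.le.trans hlr), heq]
    simp
  have hdir : hedgeDirection β (betaHedge α β x i) (x (i + 1)) = !₂[-sin β, cos β] := by
    rw [hedgeDirection, if_neg]
    have := mul_nonneg hp1 ht.le
    unfold coverLeft at hl
    linarith
  have hit : hitDistance (betaHedge α β x i) !₂[-sin β, cos β] (feasibilityCone α x (i + 1)) =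
      (-x (i + 1) - coverLeft α (betaHedge α β x i)) / hedgeSpeed α β := by
    have hs : 0 ≤ (-x (i + 1) - coverLeft α (betaHedge α β x i)) / hedgeSpeed α β :=
      div_nonneg (by linarith) hW.le
    have hA : 0 ≤ -sin β + cos β * tan α := by
      rw [neg_add_eq_sub, cos_mul_tan_sub_sin hα hβ]
      exact mul_nonneg (by linarith [(coeffA_mem_Icc hα hβ).2]) hW.le
    have hW' : cos β * tan α - -sin β = hedgeSpeed α β := by unfold hedgeSpeed; ring
    refine IsLeast.csInf_eq ⟨⟨hs, ?_⟩, ?_⟩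
    · rw [mem_feasibilityCone, coverRight_add_smul, coverLeft_add_smul, hW',
        div_mul_cancel₀ _ hW.ne']
      have e2 := mul_nonneg hs hA
      intro j hj
      refine ⟨?_, ?_, ?_⟩
      · have := mul_nonneg hs (cos_pos_of_mem hα hβ).le
        simp only [PiLp.add_apply, PiLp.smul_apply, smul_eq_mul]
        simpa using add_nonneg hp1 this
      · rcases Nat.le_succ_iff.1 hj with h | rfl
        · linarith [(hP' j h).2.1]
        · linarith
      · rcases Nat.le_succ_iff.1 hj with h | rfl
        · linarith [(hP' j h).2.2]
        · linarith
    · rintro τ ⟨-, hτ⟩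
      rw [mem_feasibilityCone, coverLeft_add_smul, hW'] at hτ
      rw [div_le_iff₀ hW]
      linarith [(hτ (i + 1) le_rfl).2.1]
  rw [betaHedge, hdir, hit]

lemma coverage_of_right_move (hα : α ∈ Ioo 0 (π / 2)) (hβ : β ∈ Icc 0 α) {P : Plane} {δ : ℝ}
    (hδ : 0 ≤ δ) :
    coverRight α (P + (δ / hedgeSpeed α β) • !₂[sin β, cos β]) = coverRight α P + δ ∧
    coverLeft α (P + (δ / hedgeSpeed α β) • !₂[sin β, cos β]) =
      coverLeft α P + (1 - coeffA α β) * δ ∧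
    dist P (P + (δ / hedgeSpeed α β) • !₂[sin β, cos β]) = δ / hedgeSpeed α β := by
  have hW := hedgeSpeed_pos hα hβ
  rw [coverRight_add_smul, coverLeft_add_smul, cos_mul_tan_sub_sin hα hβ]
  refine ⟨?_, ?_, dist_add_smul_unit P (by positivity) (sin_sq_add_cos_sq β)⟩
  · change _ + _ / _ * hedgeSpeed α β = _
    rw [div_mul_cancel₀ _ hW.ne']
  · field_simp

lemma coverage_of_left_move (hα : α ∈ Ioo 0 (π / 2)) (hβ : β ∈ Icc 0 α) {P : Plane} {δ : ℝ}
    (hδ : 0 ≤ δ) :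
    coverRight α (P + (δ / hedgeSpeed α β) • !₂[-sin β, cos β]) =
      coverRight α P + (1 - coeffA α β) * δ ∧
    coverLeft α (P + (δ / hedgeSpeed α β) • !₂[-sin β, cos β]) = coverLeft α P + δ ∧
    dist P (P + (δ / hedgeSpeed α β) • !₂[-sin β, cos β]) = δ / hedgeSpeed α β := by
  have hW := hedgeSpeed_pos hα hβ
  have hW' : cos β * tan α - -sin β = hedgeSpeed α β := by unfold hedgeSpeed; ring
  rw [coverRight_add_smul, coverLeft_add_smul, neg_add_eq_sub, cos_mul_tan_sub_sin hα hβ, hW']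
  refine ⟨?_, ?_, dist_add_smul_unit P (by positivity) (by rw [neg_sq, sin_sq_add_cos_sq])⟩
  · field_simp
  · rw [div_mul_cancel₀ _ hW.ne']

end Step

/-! ### Extreme requests and the feasibility cone -/

lemma leftmost_zero (x : ℕ → ℝ) : leftmost x 0 = x 0 := by simp [leftmost]
lemma rightmost_zero (x : ℕ → ℝ) : rightmost x 0 = x 0 := by simp [rightmost]

lemma leftmost_le {x : ℕ → ℝ} {i j : ℕ} (h : j ≤ i) : leftmost x i ≤ x j :=
  Finset.inf'_le _ (Finset.mem_range.2 (Nat.lt_succ_of_le h))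

lemma le_rightmost {x : ℕ → ℝ} {i j : ℕ} (h : j ≤ i) : x j ≤ rightmost x i :=
  Finset.le_sup' x (Finset.mem_range.2 (Nat.lt_succ_of_le h))

lemma exists_eq_leftmost (x : ℕ → ℝ) (i : ℕ) : ∃ j ≤ i, x j = leftmost x i := by
  obtain ⟨j, hj, h⟩ := Finset.exists_mem_eq_inf' (s := Finset.range (i + 1))
    Finset.nonempty_range_add_one x
  exact ⟨j, Nat.le_of_lt_succ (Finset.mem_range.1 hj), h.symm⟩

lemma exists_eq_rightmost (x : ℕ → ℝ) (i : ℕ) : ∃ j ≤ i, x j = rightmost x i := by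
  obtain ⟨j, hj, h⟩ := Finset.exists_mem_eq_sup' (s := Finset.range (i + 1))
    Finset.nonempty_range_add_one x
  exact ⟨j, Nat.le_of_lt_succ (Finset.mem_range.1 hj), h.symm⟩

lemma leftmost_succ (x : ℕ → ℝ) (i : ℕ) : leftmost x (i + 1) = min (leftmost x i) (x (i + 1)) := by
  apply le_antisymm
  · obtain ⟨j, hj, h⟩ := exists_eq_leftmost x i
    exact le_min (h ▸ leftmost_le (hj.trans (Nat.le_succ i))) (leftmost_le le_rfl)
  · obtain ⟨j, hj, h⟩ := exists_eq_leftmost x (i + 1)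
    rw [← h]
    rcases Nat.le_succ_iff.1 hj with h' | rfl
    · exact (min_le_left _ _).trans (leftmost_le h')
    · exact min_le_right _ _

lemma rightmost_succ (x : ℕ → ℝ) (i : ℕ) :
    rightmost x (i + 1) = max (rightmost x i) (x (i + 1)) := by
  apply le_antisymm
  · obtain ⟨j, hj, h⟩ := exists_eq_rightmost x (i + 1)
    rw [← h]
    rcases Nat.le_succ_iff.1 hj with h' | rfl
    · exact (le_rightmost h').trans (le_max_left _ _)
    · exact le_max_right _ _
  · obtain ⟨j, hj, h⟩ := exists_eq_rightmost x i
    exact max_le (h ▸ le_rightmost (hj.trans (Nat.le_succ i))) (le_rightmost le_rfl)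

lemma mem_feasibilityCone_iff {α : ℝ} {x : ℕ → ℝ} {i : ℕ} {P : Plane} :
    P ∈ feasibilityCone α x i ↔
      0 ≤ P 1 ∧ -coverLeft α P ≤ leftmost x i ∧ rightmost x i ≤ coverRight α P := by
  rw [mem_feasibilityCone]
  constructor
  · intro h
    obtain ⟨j, hj, e⟩ := exists_eq_leftmost x i
    obtain ⟨k, hk, f⟩ := exists_eq_rightmost x i
    exact ⟨(h j hj).1, e ▸ (h j hj).2.1, f ▸ (h k hk).2.2⟩
  · rintro ⟨h0, h1, h2⟩ j hj
    exact ⟨h0, h1.trans (leftmost_le hj), (le_rightmost hj).trans h2⟩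

/-- The coverage interval has signed length `2 * P 1 * tan α`; containing a nonempty interval forces
this, hence the height, to be nonnegative. -/
lemma mem_feasibilityCone_iff_of_tan_pos {α : ℝ} (ht : 0 < tan α) {x : ℕ → ℝ} {i : ℕ}
    {P : Plane} :
    P ∈ feasibilityCone α x i ↔
      -coverLeft α P ≤ leftmost x i ∧ rightmost x i ≤ coverRight α P := by
  rw [mem_feasibilityCone_iff]
  refine ⟨fun h => h.2, fun h => ⟨?_, h⟩⟩
  have h1 : leftmost x i ≤ rightmost x i := (leftmost_le le_rfl).trans (le_rightmost le_rfl)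
  have h2 : 0 ≤ P 1 * tan α := by
    have := h.1.trans (h1.trans h.2)
    unfold coverLeft coverRight at this
    linarith
  exact nonneg_of_mul_nonneg_left h2 ht

lemma netCost_succ (P : ℕ → Plane) (n : ℕ) :
    netCost P (n + 1) = netCost P n + dist (P n) (P (n + 1)) := Finset.sum_range_succ _ _

/-! ### Cost of the algorithm -/

/-- Here `p` and `q` accumulate the coverage gained by right and left moves. The two entries of the
maximum correspond to the side of the last actual move. -/
lemma betaHedge_invariant {α β : ℝ} (hα : α ∈ Ioo 0 (π / 2)) (hβ : β ∈ Icc 0 α) {x : ℕ → ℝ}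
    (hx : x 0 = 0) (i : ℕ) :
    betaHedge α β x i ∈ feasibilityCone α x i ∧ ∃ p q : ℝ, 0 ≤ p ∧ 0 ≤ q ∧
      netCost (betaHedge α β x) i = (p + q) / hedgeSpeed α β ∧
      coverRight α (betaHedge α β x i) = p + (1 - coeffA α β) * q ∧
      coverLeft α (betaHedge α β x i) = q + (1 - coeffA α β) * p ∧
      p ≤ rightmost x i ∧ q ≤ -leftmost x i ∧
      p + q ≤ max (-leftmost x i + coeffA α β * rightmost x i)
        (rightmost x i + coeffA α β * -leftmost x i) := by
  have ht := tan_pos_of_pos_of_lt_pi_div_two hα.1 hα.2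
  obtain ⟨hA0, hA1⟩ := coeffA_mem_Icc hα hβ
  have hA2 : 0 ≤ 1 - coeffA α β := by linarith
  simp only [mem_feasibilityCone_iff_of_tan_pos ht]
  induction i with
  | zero =>
    have e1 : coverRight α (betaHedge α β x 0) = 0 := by simp [betaHedge, coverRight]
    have e2 : coverLeft α (betaHedge α β x 0) = 0 := by simp [betaHedge, coverLeft]
    rw [leftmost_zero, rightmost_zero, hx, e1, e2]
    exact ⟨by simp, 0, 0, by simp [netCost]⟩
  | succ i ih =>
    obtain ⟨hc, p, q, hp, hq, hcost, hu, hv, hpR, hqL, hmax⟩ := ih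
    have hmem := (mem_feasibilityCone_iff_of_tan_pos ht).2 hc
    have hL : leftmost x i ≤ 0 := hx ▸ leftmost_le (Nat.zero_le i)
    have hR : 0 ≤ rightmost x i := hx ▸ le_rightmost (Nat.zero_le i)
    rw [netCost_succ, leftmost_succ, rightmost_succ]
    rcases le_total (x (i + 1)) (-coverLeft α (betaHedge α β x i)) with hl | hl
    · have hδ : 0 ≤ -x (i + 1) - coverLeft α (betaHedge α β x i) := by linarith
      obtain ⟨m1, m2, m3⟩ := coverage_of_left_move hα hβ (P := betaHedge α β x i) hδ
      have e1 : min (leftmost x i) (x (i + 1)) = x (i + 1) := min_eq_right (by linarith)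
      have e2 : max (rightmost x i) (x (i + 1)) = rightmost x i := max_eq_left (by linarith)
      rw [betaHedge_succ_of_left hα hβ hmem hl, m1, m2, m3, e1, e2, hcost]
      set δ := -x (i + 1) - coverLeft α (betaHedge α β x i) with hδd
      have hk := mul_nonneg hA2 hδ
      have hkp := mul_nonneg hA2 hp
      have hAp := mul_le_mul_of_nonneg_left hpR hA0
      -- The new left coverage is exactly `-x (i + 1)`, so the new sum is `-x (i + 1) + A * p`, and
      -- `p ≤ rightmost x i` yields the first entry of the maximum.
      refine ⟨⟨by linarith, by linarith⟩, p, q + δ, hp, by linarith, ?_, ?_, ?_, hpR,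
        by linarith, le_max_of_le_left (by linarith)⟩
      · rw [← add_div, add_assoc]
      · rw [hu]; ring
      · rw [hv]; ring
    · rcases le_total (x (i + 1)) (coverRight α (betaHedge α β x i)) with hr | hr
      · rw [betaHedge_succ_of_covered hmem hl hr, dist_self, add_zero]
        have hR' := le_max_left (rightmost x i) (x (i + 1))
        have hL' := min_le_left (leftmost x i) (x (i + 1))
        refine ⟨⟨le_min hc.1 hl, max_le hc.2 hr⟩, p, q, hp, hq, hcost, hu, hv, hpR.trans hR',
          by linarith, hmax.trans (max_le_max ?_ ?_)⟩
        · exact add_le_add (by linarith) (mul_le_mul_of_nonneg_left hR' hA0)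
        · exact add_le_add hR' (mul_le_mul_of_nonneg_left (by linarith) hA0)
      · have hδ : 0 ≤ x (i + 1) - coverRight α (betaHedge α β x i) := by linarith
        obtain ⟨m1, m2, m3⟩ := coverage_of_right_move hα hβ (P := betaHedge α β x i) hδ
        have e1 : min (leftmost x i) (x (i + 1)) = leftmost x i := min_eq_left (by linarith)
        have e2 : max (rightmost x i) (x (i + 1)) = x (i + 1) := max_eq_right (by linarith)
        rw [betaHedge_succ_of_right hα hβ hmem hr, m1, m2, m3, e1, e2, hcost]
        set δ := x (i + 1) - coverRight α (betaHedge α β x i) with hδd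
        have hk := mul_nonneg hA2 hδ
        have hkq := mul_nonneg hA2 hq
        have hAq := mul_le_mul_of_nonneg_left hqL hA0
        refine ⟨⟨by linarith, by linarith⟩, p + δ, q, by linarith, hq, ?_, ?_, ?_, by linarith,
          hqL, le_max_of_le_right (by linarith)⟩
        · rw [← add_div]; ring
        · rw [hu]; ring
        · rw [hv]; ring

lemma netCost_betaHedge_le {α β : ℝ} (hα : α ∈ Ioo 0 (π / 2)) (hβ : β ∈ Icc 0 α) {n : ℕ}
    {x : ℕ → ℝ} (hx : GoodInput n x) :
    netCost (betaHedge α β x) n ≤ (1 + coeffA α β * rightmost x n) / hedgeSpeed α β := by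
  obtain ⟨-, p, q, -, -, hcost, -, -, -, -, hmax⟩ := betaHedge_invariant hα hβ hx.zero n
  have hA := coeffA_mem_Icc hα hβ
  rw [hcost]
  refine div_le_div_of_nonneg_right (hmax.trans (max_le ?_ ?_)) (hedgeSpeed_pos hα hβ).le
  · rw [hx.left, neg_neg]
  · rw [hx.left]
    -- The two entries of the maximum differ by `(1 - A) * (1 - r)`.
    nlinarith [mul_nonneg (sub_nonneg.2 hA.2) (sub_nonneg.2 hx.right)]

/-! ### Bounds for the offline optimum -/

section Opt

variable {α : ℝ} {x : ℕ → ℝ} {n : ℕ}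

lemma dist_le_netCost (P : ℕ → Plane) (n : ℕ) : dist (P 0) (P n) ≤ netCost P n :=
  dist_le_range_sum_dist P n

lemma netCost_nonneg (P : ℕ → Plane) (n : ℕ) : 0 ≤ netCost P n :=
  Finset.sum_nonneg fun _ _ => dist_nonneg

lemma isSolution_of_mem (ht : 0 < tan α) (hx : x 0 = 0) {P : Plane}
    (hP : P ∈ feasibilityCone α x n) :
    IsSolution α x n (fun i => if i = 0 then 0 else P) := by
  refine ⟨by simp, fun i hi => ?_⟩
  by_cases h : i = 0
  · subst h
    simp [mem_feasibilityCone_iff_of_tan_pos ht, leftmost_zero, rightmost_zero, hx, coverLeft,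
      coverRight]
  · simp only [if_neg h]
    exact fun j hj => hP j (hj.trans hi)

/-- Going straight to a point that covers all requests is a solution. -/
lemma opt_le_norm (ht : 0 < tan α) (hx : x 0 = 0) (hn : n ≠ 0) {P : Plane}
    (hP : P ∈ feasibilityCone α x n) : opt α x n ≤ ‖P‖ := by
  refine csInf_le ⟨0, by rintro _ ⟨Q, -, rfl⟩; exact netCost_nonneg Q n⟩
    ⟨_, isSolution_of_mem ht hx hP, ?_⟩
  obtain ⟨m, rfl⟩ := Nat.exists_eq_succ_of_ne_zero hn
  rw [netCost, Finset.sum_range_succ']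
  simp

lemma le_opt (ht : 0 < tan α) (hx : x 0 = 0) {b : ℝ}
    (h : ∀ P ∈ feasibilityCone α x n, b ≤ ‖P‖) : b ≤ opt α x n := by
  refine le_csInf ?_ ?_
  · set M := max (rightmost x n) (-leftmost x n) with hM
    let Q : Plane := !₂[0, M / tan α]
    have hQ1 : coverRight α Q = M := by simp [Q, coverRight, ht.ne']
    have hQ2 : coverLeft α Q = M := by simp [Q, coverLeft, ht.ne']
    have hQ : Q ∈ feasibilityCone α x n := by
      rw [mem_feasibilityCone_iff_of_tan_pos ht, hQ1, hQ2]
      exact ⟨by linarith [le_max_right (rightmost x n) (-leftmost x n)], le_max_left _ _⟩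
    exact ⟨_, _, isSolution_of_mem ht hx hQ, rfl⟩
  · rintro _ ⟨P, ⟨h0, hP⟩, rfl⟩
    have := dist_le_netCost P n
    rw [h0, dist_zero_left] at this
    exact (h _ (hP n le_rfl)).trans this

end Opt

/-! ### Upper bound on the ratio -/

/-- The norm of a point in terms of its coverage. -/
lemma norm_sq_eq {α : ℝ} (hα : α ∈ Ioo 0 (π / 2)) (P : Plane) :
    (2 * sin α) ^ 2 * ‖P‖ ^ 2 = coverRight α P ^ 2 + coverLeft α P ^ 2 +
      2 * cos (2 * α) * (coverRight α P * coverLeft α P) := by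
  have hc : cos α ≠ 0 := (cos_pos_of_mem_Ioo ⟨by linarith [hα.1, pi_pos], hα.2⟩).ne'
  have h1 : tan α * cos α = sin α := tan_mul_cos hc
  have h2 := sin_sq_add_cos_sq α
  rw [EuclideanSpace.norm_sq_eq, cos_two_mul, coverRight, coverLeft]
  simp only [Fin.sum_univ_two, Real.norm_eq_abs, sq_abs]
  rw [← h1] at h2 ⊢
  have h3 : (cos α) ^ 2 * (1 + tan α ^ 2) = 1 := by linarith
  linear_combination (4 * P 0 ^ 2) * h3

/-- The maximum over all `r` of `f₁ α β r`. -/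
noncomputable def hedgeRatio (α β : ℝ) : ℝ :=
  2 * sin α / hedgeSpeed α β *
    √((1 - 2 * cos (2 * α) * coeffA α β + coeffA α β ^ 2) / (1 - cos (2 * α) ^ 2))

lemma one_sub_cos_two_mul_sq_pos {α : ℝ} (hα : α ∈ Ioo 0 (π / 2)) : 0 < 1 - cos (2 * α) ^ 2 := by
  have := sin_pos_of_pos_of_lt_pi (x := 2 * α) (by linarith [hα.1]) (by linarith [hα.2])
  rw [← sin_sq]
  positivity

lemma one_sub_mul_add_sq_pos {c A : ℝ} (hc : 0 < 1 - c ^ 2) : 0 < 1 - 2 * c * A + A ^ 2 := by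
  nlinarith [sq_nonneg (A - c)]

lemma sin_pos_of_mem {α : ℝ} (hα : α ∈ Ioo 0 (π / 2)) : 0 < sin α :=
  sin_pos_of_pos_of_lt_pi hα.1 (by linarith [hα.2, pi_pos])

lemma hedgeRatio_pos {α β : ℝ} (hα : α ∈ Ioo 0 (π / 2)) (hβ : β ∈ Icc 0 α) :
    0 < hedgeRatio α β := by
  have h1 := one_sub_cos_two_mul_sq_pos hα
  have h2 := one_sub_mul_add_sq_pos (A := coeffA α β) h1
  have h3 := hedgeSpeed_pos hα hβ
  have h4 := sin_pos_of_mem hα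
  unfold hedgeRatio
  positivity

/-- Cauchy–Schwarz applies to every point of the final cone, so its point nearest to the origin need
not be located. -/
lemma netCost_betaHedge_le_mul_opt {α β : ℝ} (hα : α ∈ Ioo 0 (π / 2)) (hβ : β ∈ Icc 0 α) {n : ℕ}
    {x : ℕ → ℝ} (hx : GoodInput n x) :
    netCost (betaHedge α β x) n ≤ hedgeRatio α β * opt α x n := by
  have ht := tan_pos_of_pos_of_lt_pi_div_two hα.1 hα.2
  have hρ := hedgeRatio_pos hα hβ
  have hc := one_sub_cos_two_mul_sq_pos hα
  have hM := one_sub_mul_add_sq_pos (A := coeffA α β) hc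
  have hA := (coeffA_mem_Icc hα hβ).1
  have hW := hedgeSpeed_pos hα hβ
  have hs := sin_pos_of_mem hα
  have hR : 0 ≤ rightmost x n := hx.zero ▸ le_rightmost (Nat.zero_le n)
  rw [← div_le_iff₀' hρ]
  refine le_opt ht hx.zero fun P hP => ?_
  rw [div_le_iff₀' hρ]
  refine (netCost_betaHedge_le hα hβ hx).trans ?_
  obtain ⟨hl, hr⟩ := (mem_feasibilityCone_iff_of_tan_pos ht).1 hP
  rw [hx.left] at hl
  have hN := norm_sq_eq hα P
  set u := coverRight α P
  set v := coverLeft α P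
  set A := coeffA α β
  set c := cos (2 * α)
  have h1 : 1 + A * rightmost x n ≤ v + A * u :=
    add_le_add (by linarith) (mul_le_mul_of_nonneg_left hr hA)
  have h2 : v + A * u ≤ √((1 - 2 * c * A + A ^ 2) / (1 - c ^ 2)) * (2 * sin α * ‖P‖) := by
    refine le_of_sq_le_sq ?_ (by positivity)
    rw [mul_pow, sq_sqrt (by positivity), mul_pow, hN, div_mul_eq_mul_div, le_div_iff₀ hc]
    -- This square is exactly the defect in Cauchy–Schwarz. It vanishes for `v = 1` at `u = (A - c)
    -- / (1 - A * c)`, which is `r₀`.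
    nlinarith [sq_nonneg ((u - A * v) + c * (v - A * u))]
  have h3 : hedgeRatio α β * ‖P‖ =
      √((1 - 2 * c * A + A ^ 2) / (1 - c ^ 2)) * (2 * sin α * ‖P‖) / hedgeSpeed α β := by
    unfold hedgeRatio
    ring
  rw [h3]
  exact div_le_div_of_nonneg_right (h1.trans h2) hW.le

lemma competitiveRatio_betaHedge_le {α β : ℝ} (hα : α ∈ Ioo 0 (π / 2)) (hβ : β ∈ Icc 0 α) :
    competitiveRatio α (betaHedge α β) ≤ (hedgeRatio α β : EReal) := by
  refine iSup_le fun n => iSup_le fun x => iSup_le fun hx => EReal.coe_le_coe_iff.2 ?_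
  refine div_le_of_le_mul₀ ?_ (hedgeRatio_pos hα hβ).le (netCost_betaHedge_le_mul_opt hα hβ hx)
  exact Real.sInf_nonneg (by rintro _ ⟨Q, -, rfl⟩; exact netCost_nonneg Q n)

/-! ### Worst-case inputs -/

/-- If the cost of the `β`-Hedge algorithm is the largest possible one, the ratio is at least
`f₁`. -/
lemma f₁_le_of_netCost_eq {α β : ℝ} (hα : α ∈ Ioo 0 (π / 2)) (hβ : β ∈ Icc 0 α) {n : ℕ}
    {x : ℕ → ℝ} (hx : GoodInput n x)
    (hcost : netCost (betaHedge α β x) n =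
      (1 + coeffA α β * rightmost x n) / hedgeSpeed α β) :
    f₁ α β (rightmost x n) ≤ netCost (betaHedge α β x) n / opt α x n := by
  have ht := tan_pos_of_pos_of_lt_pi_div_two hα.1 hα.2
  have hρ := hedgeRatio_pos hα hβ
  have hA := (coeffA_mem_Icc hα hβ).1
  have hW := hedgeSpeed_pos hα hβ
  have hs := sin_pos_of_mem hα
  have hR : 0 ≤ rightmost x n := hx.zero ▸ le_rightmost (Nat.zero_le n)
  have hcpos : 0 < netCost (betaHedge α β x) n := by rw [hcost]; positivity
  -- A zero optimum would make the quotient `0` by convention; the upper bound on the cost excludes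
  -- it.
  have hopt : 0 < opt α x n :=
    pos_of_mul_pos_right (hcpos.trans_le (netCost_betaHedge_le_mul_opt hα hβ hx)) hρ.le
  have hn : n ≠ 0 := by
    rintro rfl
    have := hx.left
    rw [leftmost_zero, hx.zero] at this
    norm_num at this
  set r := rightmost x n with hr
  -- The apex of the final cone: its coverage is exactly `[-1, r]`. It need not be optimal, as only
  -- an upper bound on `opt` is used.
  let Q : Plane := !₂[(r - 1) / 2, (r + 1) / (2 * tan α)]
  have hQ1 : coverRight α Q = r := by simp [Q, coverRight]; field_simp; ring
  have hQ2 : coverLeft α Q = 1 := by simp [Q, coverLeft]; field_simp; ring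
  have hQ : Q ∈ feasibilityCone α x n := by
    rw [mem_feasibilityCone_iff_of_tan_pos ht, hQ1, hQ2, hx.left]
    exact ⟨le_rfl, hr.ge⟩
  have hN := norm_sq_eq hα Q
  rw [hQ1, hQ2] at hN
  have hle := opt_le_norm ht hx.zero hn hQ
  have hN' : √(1 + r ^ 2 + 2 * cos (2 * α) * r) = 2 * sin α * ‖Q‖ := by
    rw [sqrt_eq_iff_mul_self_eq_of_pos (by have := hopt.trans_le hle; positivity)]
    linear_combination hN
  have hf : f₁ α β r = netCost (betaHedge α β x) n / ‖Q‖ := by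
    have := hopt.trans_le hle
    rw [f₁, hN', ← hedgeSpeed_eq hα hβ, hcost, coeffA]
    field_simp
  rw [hf]
  exact div_le_div_of_nonneg_left hcpos.le hopt hle

/-- Every value `f₁ α β r` is a lower bound for the ratio on some good input. -/
lemma exists_goodInput {α β r : ℝ} (hα : α ∈ Ioo 0 (π / 2)) (hβ : β ∈ Icc 0 α)
    (hr : r ∈ Icc 0 1) :
    ∃ (n : ℕ) (x : ℕ → ℝ), GoodInput n x ∧ rightmost x n = r ∧
      f₁ α β r ≤ netCost (betaHedge α β x) n / opt α x n := by
  have hW := hedgeSpeed_pos hα hβ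
  obtain ⟨hA0, hA1⟩ := coeffA_mem_Icc hα hβ
  have ht := tan_pos_of_pos_of_lt_pi_div_two hα.1 hα.2
  rcases hr.1.eq_or_lt with h0 | h0
  · let x : ℕ → ℝ := fun i => if i = 0 then 0 else -1
    have x0 : x 0 = 0 := by simp [x]
    have x1 : x 1 = -1 := by simp [x]
    have hR : rightmost x 1 = 0 := by
      rw [rightmost_succ, rightmost_zero, zero_add, x0, x1]; norm_num
    have hL : leftmost x 1 = -1 := by
      rw [leftmost_succ, leftmost_zero, zero_add, x0, x1]; norm_num
    have hx : GoodInput 1 x := by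
      refine ⟨x0, ?_, hL, by rw [hR]; norm_num⟩
      intro i hi
      obtain rfl : i = 0 := by omega
      rw [leftmost_zero, zero_add, x0, x1]
      norm_num
    refine ⟨1, x, hx, hR.trans h0, ?_⟩
    have := f₁_le_of_netCost_eq hα hβ hx ?_
    · rwa [hR, h0] at this
    have hmem := (betaHedge_invariant hα hβ x0 0).1
    have e2 : coverLeft α (betaHedge α β x 0) = 0 := by simp [betaHedge, coverLeft]
    have hs := betaHedge_succ_of_left hα hβ hmem (by rw [e2, zero_add, x1]; norm_num)
    have hd := (coverage_of_left_move hα hβ (P := betaHedge α β x 0) (δ := 1) zero_le_one).2.2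
    rw [e2, zero_add, x1, neg_neg, sub_zero] at hs
    rw [netCost_succ, zero_add, hs, hd, hR]
    simp [netCost]
  · let x : ℕ → ℝ := fun i => if i = 0 then 0 else if i = 1 then r else -1
    have x0 : x 0 = 0 := by simp [x]
    have x1 : x 1 = r := by simp [x]
    have x2 : x 2 = -1 := by simp [x]
    have hR1 : rightmost x 1 = r := by
      rw [rightmost_succ, rightmost_zero, zero_add, x0, x1, max_eq_right hr.1]
    have hL1 : leftmost x 1 = 0 := by
      rw [leftmost_succ, leftmost_zero, zero_add, x0, x1, min_eq_left hr.1]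
    have hR : rightmost x 2 = r := by
      rw [rightmost_succ, hR1, one_add_one_eq_two, x2, max_eq_left (by linarith)]
    have hL : leftmost x 2 = -1 := by
      rw [leftmost_succ, hL1, one_add_one_eq_two, x2]; norm_num
    have hx : GoodInput 2 x := by
      refine ⟨x0, ?_, hL, by rw [hR]; exact hr.2⟩
      intro i hi
      interval_cases i
      · rw [leftmost_zero, rightmost_zero, zero_add, x0, x1]
        exact fun h => h0.not_ge h.2
      · rw [hL1, one_add_one_eq_two, x2]
        exact fun h => absurd h.1 (by norm_num)
    refine ⟨2, x, hx, hR, ?_⟩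
    have := f₁_le_of_netCost_eq hα hβ hx ?_
    · rwa [hR] at this
    have hmem0 := (betaHedge_invariant hα hβ x0 0).1
    have hmem1 := (betaHedge_invariant hα hβ x0 1).1
    have e1 : coverRight α (betaHedge α β x 0) = 0 := by simp [betaHedge, coverRight]
    have e2 : coverLeft α (betaHedge α β x 0) = 0 := by simp [betaHedge, coverLeft]
    have hs0 := betaHedge_succ_of_right hα hβ hmem0 (by rw [e1, zero_add, x1]; exact hr.1)
    obtain ⟨-, hl0, hd0⟩ := coverage_of_right_move hα hβ (P := betaHedge α β x 0) hr.1
    rw [e1, zero_add, x1, sub_zero] at hs0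
    rw [← hs0, e2, zero_add] at hl0
    rw [← hs0] at hd0
    -- The right move leaves `-1` at or beyond the left end, so the second move gains `1 - (1 - A) *
    -- r` and the gains sum to `1 + A * r`.
    have hκ : (1 - coeffA α β) * r ≤ 1 :=
      mul_le_one₀ (by linarith) hr.1 hr.2
    have hs1 := betaHedge_succ_of_left hα hβ hmem1
      (by rw [hl0, one_add_one_eq_two, x2]; linarith)
    have hd1 := (coverage_of_left_move hα hβ (P := betaHedge α β x 1)
      (sub_nonneg.2 hκ)).2.2
    rw [hl0, one_add_one_eq_two, x2, neg_neg] at hs1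
    rw [netCost_succ, netCost_succ, one_add_one_eq_two, hs1, hd1, zero_add, hd0, hR]
    simp only [netCost, Finset.range_zero, Finset.sum_empty]
    rw [zero_add, ← add_div]
    ring

lemma f₁_r₀ {α β : ℝ} (hα : α ∈ Ioo 0 (π / 2)) (hβ : β ∈ Icc 0 α) :
    f₁ α β (r₀ α β) = hedgeRatio α β := by
  have hc := one_sub_cos_two_mul_sq_pos hα
  obtain ⟨hA0, hA1⟩ := coeffA_mem_Icc hα hβ
  have hM := one_sub_mul_add_sq_pos (A := coeffA α β) hc
  rw [f₁, ← hedgeSpeed_eq hα hβ, hedgeRatio, r₀, coeffB]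
  change _ / _ * ((1 + coeffA α β * _) / _) = _
  set A := coeffA α β
  set c := cos (2 * α)
  have hAc : 0 < 1 - A * c := by
    have : c < 1 := by nlinarith
    nlinarith
  have hD : 2 - A * (2 * c) ≠ 0 := by nlinarith
  congr 1
  have e1 : 1 + A * ((2 * A - 2 * c) / (2 - A * (2 * c))) =
      (1 - 2 * c * A + A ^ 2) / (1 - A * c) := by
    field_simp
    ring
  have e2 : 1 + ((2 * A - 2 * c) / (2 - A * (2 * c))) ^ 2 +
      2 * c * ((2 * A - 2 * c) / (2 - A * (2 * c))) =
      (1 - 2 * c * A + A ^ 2) * (1 - c ^ 2) / (1 - A * c) ^ 2 := by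
    field_simp
    ring
  rw [e1, e2, sqrt_div (by positivity), sqrt_sq hAc.le, sqrt_div hM.le, sqrt_mul hM.le]
  have h1 := sqrt_pos.2 hM
  have h2 := sqrt_pos.2 hc
  field_simp
  rw [sq_sqrt hM.le, mul_comm c A, mul_div_assoc, div_self hAc.ne', mul_one]

/-! ### Minimization over the coefficient -/

lemma tan_sq_eq {α : ℝ} (hα : α ∈ Ioo 0 (π / 2)) :
    cos (2 * α) * (1 + tan α ^ 2) = 1 - tan α ^ 2 := by
  have hc : cos α ≠ 0 := (cos_pos_of_mem_Ioo ⟨by linarith [hα.1, pi_pos], hα.2⟩).ne'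
  have h1 : tan α * cos α = sin α := tan_mul_cos hc
  have h2 := sin_sq_add_cos_sq α
  rw [← h1] at h2
  rw [cos_two_mul]
  linear_combination 2 * h2

lemma sq_two_mul_sin_div_hedgeSpeed {α β : ℝ} (hα : α ∈ Ioo 0 (π / 2)) (hβ : β ∈ Icc 0 α) :
    (2 * sin α / hedgeSpeed α β) ^ 2 =
      coeffA α β ^ 2 - 2 * (1 + cos (2 * α)) * coeffA α β + 2 * (1 + cos (2 * α)) := by
  have ht := tan_pos_of_pos_of_lt_pi_div_two hα.1 hα.2
  have hb := (tan_mem_Icc hα hβ).1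
  have hcα := cos_pos_of_mem hα (right_mem_Icc.2 hα.1.le)
  have hcβ := cos_pos_of_mem hα hβ
  have hs : sin α = tan α * cos α := (tan_mul_cos hcα.ne').symm
  have h1 : cos α ^ 2 = 1 / (1 + tan α ^ 2) := by rw [one_div, ← inv_one_add_tan_sq hcα.ne']
  have h2 : cos β ^ 2 = 1 / (1 + tan β ^ 2) := by rw [one_div, ← inv_one_add_tan_sq hcβ.ne']
  rw [hedgeSpeed_eq hα hβ, hs, coeffA, cos_two_mul, div_pow, mul_pow, mul_pow, mul_pow, h1, h2]
  have h3 : tan α + tan β ≠ 0 := by positivity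
  field_simp
  ring

/-- The square of the competitive ratio, up to a factor that depends only on `α`. -/
def ratioPoly (c A : ℝ) : ℝ := (A ^ 2 - 2 * (1 + c) * A + 2 * (1 + c)) * (1 - 2 * c * A + A ^ 2)

lemma hedgeRatio_sq {α β : ℝ} (hα : α ∈ Ioo 0 (π / 2)) (hβ : β ∈ Icc 0 α) :
    hedgeRatio α β ^ 2 = ratioPoly (cos (2 * α)) (coeffA α β) / (1 - cos (2 * α) ^ 2) := by
  have hc := one_sub_cos_two_mul_sq_pos hα
  have hM := one_sub_mul_add_sq_pos (A := coeffA α β) hc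
  rw [hedgeRatio, mul_pow, sq_two_mul_sin_div_hedgeSpeed hα hβ, sq_sqrt (by positivity), ratioPoly,
    mul_div_assoc]

/-- The minimizer of `ratioPoly c` on `[0, 1]`. -/
noncomputable def bestCoeff (c : ℝ) : ℝ := max 0 (min 1 (1 / 2 + c))

lemma bestCoeff_mem (c : ℝ) : bestCoeff c ∈ Icc 0 1 :=
  ⟨le_max_left _ _, max_le zero_le_one (min_le_left _ _)⟩

/-- The quartic is even about `1/2 + c`. For `|c| ≤ 1/2` it exceeds its value there by `d ^ 2 * (d ^
2 + (3 - 4 * c ^ 2) / 2)` with `d = A - (1/2 + c)`. Otherwise the difference from the value at the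
endpoint `1` or `0` factors explicitly; this is `key` in each case. -/
lemma ratioPoly_bestCoeff_lt {c A : ℝ} (hc : c ∈ Ioo (-1) 1) (hA : A ∈ Icc 0 1)
    (hne : A ≠ bestCoeff c) : ratioPoly c (bestCoeff c) < ratioPoly c A := by
  obtain ⟨hA0, hA1⟩ := hA
  obtain ⟨hc0, hc1⟩ := hc
  unfold bestCoeff at *
  unfold ratioPoly
  rcases le_total (1 / 2) c with h | h
  · rw [min_eq_left (by linarith), max_eq_right zero_le_one] at *
    have h1 : 0 < 1 - A := sub_pos.2 (lt_of_le_of_ne hA1 hne)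
    have key : 0 < (1 - A) * ((2 * c - A) * (2 * (1 - c) + (1 - A) * (2 * c - A))) := by
      rcases eq_or_ne (2 * c - A) 0 with h0 | h0
      · exfalso; linarith
      · have : 0 < 2 * c - A := by linarith
        have : 0 < 1 - c := by linarith
        positivity
    linarith
  · rcases le_total (-(1 / 2)) c with h' | h'
    · rw [min_eq_right (by linarith), max_eq_right (by linarith)] at *
      have h1 : 0 < (A - (1 / 2 + c)) ^ 2 := by
        have := sub_ne_zero.2 hne
        positivity
      have h2 : 0 < (A - (1 / 2 + c)) ^ 2 + (3 - 4 * c ^ 2) / 2 := by nlinarith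
      nlinarith [mul_pos h1 h2]
    · rw [min_eq_right (by linarith), max_eq_left (by linarith)] at *
      have h1 : 0 < A := lt_of_le_of_ne hA0 (Ne.symm hne)
      have h2 : 0 ≤ -(1 + 2 * c) := by linarith
      have h3 : 0 < 1 + c := by linarith
      have key : 0 < A * (2 * (1 + c) * -(1 + 2 * c) + A * ((2 * c + 3 / 2) ^ 2 + 3 / 4) +
          A ^ 2 * (2 * -(1 + 2 * c)) + A ^ 3) := by positivity
      linarith

/-! ### From the coefficient back to the angle -/

lemma tan_eq_of_coeffA {α β : ℝ} (hα : α ∈ Ioo 0 (π / 2)) (hβ : β ∈ Icc 0 α) :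
    tan β = tan α * coeffA α β / (2 - coeffA α β) := by
  have ht := tan_pos_of_pos_of_lt_pi_div_two hα.1 hα.2
  have hb := (tan_mem_Icc hα hβ).1
  have h3 : tan α + tan β ≠ 0 := by positivity
  have h4 : 2 - coeffA α β ≠ 0 := by linarith [(coeffA_mem_Icc hα hβ).2]
  rw [eq_div_iff h4, coeffA]
  field_simp
  ring

lemma eq_arctan_of_coeffA {α β : ℝ} (hα : α ∈ Ioo 0 (π / 2)) (hβ : β ∈ Icc 0 α) :
    β = arctan (tan α * coeffA α β / (2 - coeffA α β)) := by
  rw [← tan_eq_of_coeffA hα hβ,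
    arctan_tan (by linarith [hβ.1, pi_pos]) (by linarith [hβ.2, hα.2])]

lemma coeffA_arctan {α A : ℝ} (hα : α ∈ Ioo 0 (π / 2)) (hA : A ∈ Icc 0 1) :
    coeffA α (arctan (tan α * A / (2 - A))) = A := by
  have ht := tan_pos_of_pos_of_lt_pi_div_two hα.1 hα.2
  have h : 0 < 2 - A := by linarith [hA.2]
  have h' : 0 < tan α + tan α * A / (2 - A) := by have := hA.1; positivity
  rw [coeffA, tan_arctan, div_eq_iff h'.ne']
  field_simp
  ring

lemma arctan_mem_Icc {α A : ℝ} (hα : α ∈ Ioo 0 (π / 2)) (hA : A ∈ Icc 0 1) :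
    arctan (tan α * A / (2 - A)) ∈ Icc 0 α := by
  have ht := tan_pos_of_pos_of_lt_pi_div_two hα.1 hα.2
  have h : 0 < 2 - A := by linarith [hA.2]
  constructor
  · rw [arctan_nonneg]
    exact div_nonneg (mul_nonneg ht.le hA.1) h.le
  · conv_rhs => rw [← arctan_tan (x := α) (by linarith [hα.1, pi_pos]) hα.2]
    refine arctan_mono ?_
    rw [div_le_iff₀ h]
    exact mul_le_mul_of_nonneg_left (by linarith [hA.2]) ht.le

lemma half_le_cos_two_mul {α : ℝ} (h0 : 0 ≤ α) (h : α ≤ π / 6) : 1 / 2 ≤ cos (2 * α) := by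
  rw [← cos_pi_div_three]
  exact cos_le_cos_of_nonneg_of_le_pi (by linarith) (by linarith [pi_pos]) (by linarith)

lemma cos_two_mul_le_half {α : ℝ} (h : π / 6 ≤ α) (h1 : α ≤ π / 2) : cos (2 * α) ≤ 1 / 2 := by
  rw [← cos_pi_div_three]
  exact cos_le_cos_of_nonneg_of_le_pi (by linarith [pi_pos]) (by linarith) (by linarith)

lemma cos_two_pi_div_three : cos (2 * (π / 3)) = -(1 / 2) := by
  rw [cos_two_mul, cos_pi_div_three]; norm_num

lemma neg_half_le_cos_two_mul {α : ℝ} (h0 : 0 ≤ α) (h : α ≤ π / 3) :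
    -(1 / 2) ≤ cos (2 * α) := by
  rw [← cos_two_pi_div_three]
  exact cos_le_cos_of_nonneg_of_le_pi (by linarith) (by linarith [pi_pos]) (by linarith)

lemma cos_two_mul_le_neg_half {α : ℝ} (h : π / 3 ≤ α) (h1 : α ≤ π / 2) :
    cos (2 * α) ≤ -(1 / 2) := by
  rw [← cos_two_pi_div_three]
  exact cos_le_cos_of_nonneg_of_le_pi (by linarith [pi_pos]) (by linarith) (by linarith)

lemma cos_two_mul_mem_Ioo {α : ℝ} (hα : α ∈ Ioo 0 (π / 2)) : cos (2 * α) ∈ Ioo (-1) 1 := by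
  have := one_sub_cos_two_mul_sq_pos hα
  constructor <;> nlinarith

/-- In the middle range `A = 1/2 + c`, and the argument of the `arccos` is `cos (2 * arctan b) = 2 /
(1 + b ^ 2) - 1`, made rational in `c` by `tan α ^ 2 = (1 - c) / (1 + c)`. -/
lemma β₀_eq_arctan {α : ℝ} (hα : α ∈ Ioo 0 (π / 2)) :
    β₀ α = arctan (tan α * bestCoeff (cos (2 * α)) / (2 - bestCoeff (cos (2 * α)))) := by
  obtain ⟨h0, h1⟩ := hα
  unfold β₀
  split_ifs with h h'
  · have := half_le_cos_two_mul h0.le h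
    rw [bestCoeff, min_eq_left (by linarith), max_eq_right zero_le_one]
    norm_num
    rw [arctan_tan (by linarith [pi_pos]) h1]
  · push Not at h
    have e1 := cos_two_mul_le_half h.le h1.le
    have e2 := neg_half_le_cos_two_mul h0.le h'.le
    have hA : bestCoeff (cos (2 * α)) = 1 / 2 + cos (2 * α) := by
      rw [bestCoeff, min_eq_right (by linarith), max_eq_right (by linarith)]
    have hmem := arctan_mem_Icc ⟨h0, h1⟩ (bestCoeff_mem (cos (2 * α)))
    have htan := tan_sq_eq ⟨h0, h1⟩
    obtain ⟨hc0, hc1⟩ := cos_two_mul_mem_Ioo ⟨h0, h1⟩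
    rw [hA] at hmem ⊢
    set b := tan α * (1 / 2 + cos (2 * α)) / (2 - (1 / 2 + cos (2 * α))) with hb
    have hX : (2 - 2 * cos (4 * α) + cos (6 * α)) / (3 - 2 * cos (4 * α)) =
        cos (2 * arctan b) := by
      rw [show 4 * α = 2 * (2 * α) by ring, show 6 * α = 3 * (2 * α) by ring, cos_two_mul (2 * α),
        cos_three_mul, cos_two_mul (arctan b), cos_sq_arctan]
      set c := cos (2 * α)
      have hd : 2 - (1 / 2 + c) ≠ 0 := by linarith
      have ht2 : tan α ^ 2 = (1 - c) / (1 + c) := by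
        rw [eq_div_iff (by linarith)]; linarith
      have hb2 : b ^ 2 = (1 - c) * (1 / 2 + c) ^ 2 / ((1 + c) * (2 - (1 / 2 + c)) ^ 2) := by
        rw [hb, div_pow, mul_pow, ht2]
        have : 1 + c ≠ 0 := by linarith
        field_simp
      have hp : 0 < 1 + c := by linarith
      have hq : 0 < (1 + c) * (2 - (1 / 2 + c)) ^ 2 := by positivity
      have h5 : 0 < 5 - 4 * c ^ 2 := by nlinarith
      have h6 : 1 + b ^ 2 =
          (5 - 4 * c ^ 2) / (2 * ((1 + c) * (2 - (1 / 2 + c)) ^ 2)) := by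
        rw [hb2, eq_div_iff (by positivity), add_mul, mul_left_comm (_ / _),
          div_mul_cancel₀ _ hq.ne']
        ring
      rw [h6, one_div_div, show 3 - 2 * (2 * c ^ 2 - 1) = 5 - 4 * c ^ 2 by ring,
        div_eq_iff h5.ne', sub_mul, mul_div_assoc', div_mul_cancel₀ _ h5.ne']
      ring
    rw [hX, arccos_cos (by linarith [hmem.1]) (by linarith [hmem.2])]
    ring
  · push Not at h'
    have := cos_two_mul_le_neg_half h' h1.le
    rw [bestCoeff, min_eq_right (by linarith), max_eq_left (by linarith)]
    simp

lemma β₀_mem_Icc {α : ℝ} (hα : α ∈ Ioo 0 (π / 2)) : β₀ α ∈ Icc 0 α := by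
  rw [β₀_eq_arctan hα]
  exact arctan_mem_Icc hα (bestCoeff_mem _)

lemma coeffA_β₀ {α : ℝ} (hα : α ∈ Ioo 0 (π / 2)) :
    coeffA α (β₀ α) = bestCoeff (cos (2 * α)) := by
  rw [β₀_eq_arctan hα, coeffA_arctan hα (bestCoeff_mem _)]

lemma coeffA_ne_of_ne_β₀ {α β : ℝ} (hα : α ∈ Ioo 0 (π / 2)) (hβ : β ∈ Icc 0 α)
    (h : β ≠ β₀ α) : coeffA α β ≠ bestCoeff (cos (2 * α)) := by
  rintro e
  exact h (by rw [eq_arctan_of_coeffA hα hβ, e, β₀_eq_arctan hα])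

lemma r₀_mem_Icc {α β : ℝ} (hα : α ∈ Ioo 0 (π / 2)) (hβ : β ∈ Icc 0 α)
    (h : cos (2 * α) ≤ coeffA α β) : r₀ α β ∈ Icc 0 1 := by
  obtain ⟨hA0, hA1⟩ := coeffA_mem_Icc hα hβ
  obtain ⟨hc0, hc1⟩ := cos_two_mul_mem_Ioo hα
  rw [r₀, coeffB]
  set A := coeffA α β
  set c := cos (2 * α)
  have hD : 0 < 2 - A * (2 * c) := by nlinarith
  refine ⟨div_nonneg (by linarith) hD.le, ?_⟩
  rw [div_le_one hD]
  -- The denominator minus the numerator is `2 * (1 - A) * (1 + c)`.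
  nlinarith

/-! ### Optimality and closed forms -/

lemma le_bestCoeff {c : ℝ} (hc : c ∈ Ioo (-1) 1) : c ≤ bestCoeff c :=
  le_max_of_le_right (le_min hc.2.le (by linarith))

lemma f₁_le_competitiveRatio {α β r : ℝ} (hα : α ∈ Ioo 0 (π / 2)) (hβ : β ∈ Icc 0 α)
    (hr : r ∈ Icc 0 1) : (f₁ α β r : EReal) ≤ competitiveRatio α (betaHedge α β) := by
  obtain ⟨n, x, hx, -, h⟩ := exists_goodInput hα hβ hr
  exact (EReal.coe_le_coe_iff.2 h).trans (le_iSup_of_le n (le_iSup₂_of_le x hx le_rfl))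

lemma competitiveRatio_β₀ {α : ℝ} (hα : α ∈ Ioo 0 (π / 2)) :
    competitiveRatio α (betaHedge α (β₀ α)) = (hedgeRatio α (β₀ α) : EReal) := by
  have hβ := β₀_mem_Icc hα
  refine le_antisymm (competitiveRatio_betaHedge_le hα hβ) ?_
  rw [← f₁_r₀ hα hβ]
  refine f₁_le_competitiveRatio hα hβ (r₀_mem_Icc hα hβ ?_)
  rw [coeffA_β₀ hα]
  exact le_bestCoeff (cos_two_mul_mem_Ioo hα)

lemma f₁_zero_sq {α β : ℝ} (hα : α ∈ Ioo 0 (π / 2)) (hβ : β ∈ Icc 0 α) :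
    f₁ α β 0 ^ 2 =
      coeffA α β ^ 2 - 2 * (1 + cos (2 * α)) * coeffA α β + 2 * (1 + cos (2 * α)) := by
  rw [← sq_two_mul_sin_div_hedgeSpeed hα hβ, f₁, hedgeSpeed_eq hα hβ]
  simp

lemma f₁_zero_pos {α β : ℝ} (hα : α ∈ Ioo 0 (π / 2)) (hβ : β ∈ Icc 0 α) : 0 < f₁ α β 0 := by
  have h1 := hedgeSpeed_pos hα hβ
  have h2 := sin_pos_of_mem hα
  rw [f₁, ← hedgeSpeed_eq hα hβ]
  simp
  positivity

/-- If `c ≤ A`, the ratio is at least `hedgeRatio α β`, and the strict minimum of the quartic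
decides. If `A < c`, then `r₀ < 0` and the bound `f₁ α β 0` is used instead: its square decreases in
`A` on `[0, c]`. -/
lemma competitiveRatio_β₀_lt {α β : ℝ} (hα : α ∈ Ioo 0 (π / 2)) (hβ : β ∈ Icc 0 α)
    (hne : β ≠ β₀ α) :
    competitiveRatio α (betaHedge α (β₀ α)) < competitiveRatio α (betaHedge α β) := by
  have hβ₀ := β₀_mem_Icc hα
  have hc := cos_two_mul_mem_Ioo hα
  have hc' := one_sub_cos_two_mul_sq_pos hα
  have hA := coeffA_mem_Icc hα hβ
  have hA₀ := coeffA_β₀ hα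
  rw [competitiveRatio_β₀ hα]
  have h0 := hedgeRatio_sq hα hβ₀
  rw [hA₀] at h0
  rcases le_or_gt (cos (2 * α)) (coeffA α β) with h | h
  · refine lt_of_lt_of_le (EReal.coe_lt_coe_iff.2 ?_)
      (f₁_le_competitiveRatio hα hβ (r₀_mem_Icc hα hβ h))
    rw [f₁_r₀ hα hβ]
    refine lt_of_pow_lt_pow_left₀ 2 (hedgeRatio_pos hα hβ).le ?_
    rw [h0, hedgeRatio_sq hα hβ]
    exact div_lt_div_of_pos_right
      (ratioPoly_bestCoeff_lt hc hA (coeffA_ne_of_ne_β₀ hα hβ hne)) hc'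
  · refine lt_of_lt_of_le (EReal.coe_lt_coe_iff.2 ?_)
      (f₁_le_competitiveRatio hα hβ (left_mem_Icc.2 zero_le_one))
    refine lt_of_pow_lt_pow_left₀ 2 (f₁_zero_pos hα hβ).le ?_
    rw [h0, f₁_zero_sq hα hβ, div_lt_iff₀ hc']
    -- At `A = c` the square of `f₁` at `0` and that of `hedgeRatio` agree, as `1 - 2 * c * A + A ^
    -- 2` becomes `1 - c ^ 2`; hence the comparison through `c`.
    have hle : ratioPoly (cos (2 * α)) (bestCoeff (cos (2 * α))) ≤
        ratioPoly (cos (2 * α)) (cos (2 * α)) := by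
      rcases eq_or_ne (cos (2 * α)) (bestCoeff (cos (2 * α))) with e | e
      · rw [← e]
      · exact (ratioPoly_bestCoeff_lt hc ⟨hA.1.trans h.le, hc.2.le⟩ e).le
    refine hle.trans_lt ?_
    rw [ratioPoly, show 1 - 2 * cos (2 * α) * cos (2 * α) + cos (2 * α) ^ 2 =
      1 - cos (2 * α) ^ 2 by ring]
    refine mul_lt_mul_of_pos_right ?_ hc'
    nlinarith [hA.1, hA.2]

lemma competitiveRatio_β₀_eq {α y : ℝ} (hα : α ∈ Ioo 0 (π / 2)) (hy : 0 ≤ y)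
    (h : ratioPoly (cos (2 * α)) (bestCoeff (cos (2 * α))) =
      y ^ 2 * (1 - cos (2 * α) ^ 2)) :
    competitiveRatio α (betaHedge α (β₀ α)) = (y : EReal) := by
  have hβ := β₀_mem_Icc hα
  rw [competitiveRatio_β₀ hα, EReal.coe_eq_coe_iff]
  refine (pow_left_inj₀ (hedgeRatio_pos hα hβ).le hy two_ne_zero).1 ?_
  rw [hedgeRatio_sq hα hβ, coeffA_β₀ hα, div_eq_iff (one_sub_cos_two_mul_sq_pos hα).ne', h]

end Drone

open Drone in
theorem mainTheorem1 (α : ℝ) (hα : α ∈ Set.Ioo 0 (Real.pi / 2)) :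
    -- the angle `β₀ α` is admissible, and is the unique optimal one
    Drone.β₀ α ∈ Set.Icc 0 α ∧
    (∀ β ∈ Set.Icc 0 α, β ≠ Drone.β₀ α →
      Drone.competitiveRatio α (Drone.betaHedge α (Drone.β₀ α)) <
        Drone.competitiveRatio α (Drone.betaHedge α β)) ∧
    -- the resulting competitive ratio
    (α < Real.pi / 6 →
      Drone.competitiveRatio α (Drone.betaHedge α (Drone.β₀ α)) = ((1 / Real.cos α : ℝ) : EReal)) ∧
    (α ∈ Set.Icc (Real.pi / 6) (Real.pi / 3) →
      Drone.competitiveRatio α (Drone.betaHedge α (Drone.β₀ α)) =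
        ((Drone.f₁ α (Drone.β₀ α) (Drone.r₀ α (Drone.β₀ α)) : ℝ) : EReal)) ∧
    (Real.pi / 3 ≤ α →
      Drone.competitiveRatio α (Drone.betaHedge α (Drone.β₀ α)) = ((1 / Real.sin α : ℝ) : EReal)) ∧
    (α = Real.pi / 4 →
      Drone.competitiveRatio α (Drone.betaHedge α (Drone.β₀ α)) = ((5 / 4 : ℝ) : EReal)) ∧
    -- the worst case is attained on an input whose rightmost request is `r₀`
    (∃ (n : ℕ) (x : ℕ → ℝ), Drone.GoodInput n x ∧
      Drone.rightmost x n = Drone.r₀ α (Drone.β₀ α) ∧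
      ((Drone.netCost (Drone.betaHedge α (Drone.β₀ α) x) n / Drone.opt α x n : ℝ) : EReal) =
        Drone.competitiveRatio α (Drone.betaHedge α (Drone.β₀ α))) ∧
    (α ≤ Real.pi / 6 → Drone.r₀ α (Drone.β₀ α) = 1) ∧
    (Real.pi / 3 ≤ α → Drone.r₀ α (Drone.β₀ α) = -Real.cos (2 * α)) := by
  have hβ := β₀_mem_Icc hα
  have hc := cos_two_mul_mem_Ioo hα
  have hr₀ : r₀ α (β₀ α) ∈ Icc 0 1 := by
    refine r₀_mem_Icc hα hβ ?_
    rw [coeffA_β₀ hα]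
    exact le_bestCoeff hc
  have hs := sin_pos_of_mem hα
  have hcos := cos_pos_of_mem hα (right_mem_Icc.2 hα.1.le)
  refine ⟨hβ, fun β hβ' hne => competitiveRatio_β₀_lt hα hβ' hne, ?_, ?_, ?_, ?_, ?_, ?_, ?_⟩
  · intro h
    have h1 := half_le_cos_two_mul hα.1.le h.le
    refine competitiveRatio_β₀_eq hα (by positivity) ?_
    rw [bestCoeff, min_eq_left (by linarith), max_eq_right zero_le_one, ratioPoly, cos_two_mul]
    field_simp
    ring
  · intro _
    rw [competitiveRatio_β₀ hα, f₁_r₀ hα hβ]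
  · intro h
    have h1 := cos_two_mul_le_neg_half h hα.2.le
    refine competitiveRatio_β₀_eq hα (by positivity) ?_
    rw [bestCoeff, min_eq_right (by linarith), max_eq_left (by linarith), ratioPoly]
    rw [show 1 - cos (2 * α) ^ 2 = 4 * sin α ^ 2 * cos α ^ 2 by
      rw [← sin_sq, sin_two_mul]; ring, cos_two_mul]
    field_simp
    ring
  · rintro rfl
    refine competitiveRatio_β₀_eq hα (by norm_num) ?_
    rw [show 2 * (π / 4) = π / 2 by ring, cos_pi_div_two, bestCoeff, ratioPoly]
    norm_num
  · obtain ⟨n, x, hx, hxr, h⟩ := exists_goodInput hα hβ hr₀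
    refine ⟨n, x, hx, hxr, le_antisymm (le_iSup_of_le n (le_iSup₂_of_le x hx le_rfl)) ?_⟩
    rw [competitiveRatio_β₀ hα, ← f₁_r₀ hα hβ]
    exact EReal.coe_le_coe_iff.2 h
  · intro h
    have h1 := half_le_cos_two_mul hα.1.le h
    rw [r₀, coeffA_β₀ hα, coeffB, bestCoeff, min_eq_left (by linarith), max_eq_right zero_le_one]
    rw [mul_one, one_mul]
    exact div_self (by linarith [hc.2])
  · intro h
    have h1 := cos_two_mul_le_neg_half h hα.2.le
    rw [r₀, coeffA_β₀ hα, coeffB, bestCoeff, min_eq_right (by linarith), max_eq_left (by linarith)]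
    ring
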